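/- Let $r\ge 1$ and $s\ge 0$ be integers and let $L>0$. A function $f:[0,1]\to\mathbb{R}$ satisfies condition $D_s$ with parameter $L$ if: for $s=0$, $f$ is Lebesgue integrable on $[0,1]$ and $\sup_{x\in[0,1]}|f(x)|\le L$; for $s\ge 1$, $f$ is $s-1$ times differentiable on $[0,1]$, $f^{(s-1)}$ is absolutely continuous on $[0,1]$, $\sup_{x\in[0,1]}|f^{(i)}(x)|\le L$ for $0\le i\le s-1$, and $|f^{(s)}(x)|\le L$ at every $x\in[0,1]$ where $f^{(s)}(x)$ exists (derivatives at the endpoints are one-sided). For $n\ge r$ and $p\in[0,1]$ let $X_1,\dots,X_n$ be i.i.d. $\mathsf{Bern}(p)$, and put $n_i=n-r+i$ for $1\le i\le r$. The delete-$1$ $r$-jackknife estimator of $f(p)$ is $$\hat f_r=\sum_{i=1}^r C_i\,\mathbb{U}_n[f(\hat p_{n_i})],\qquad C_i=\prod_{j\ne i}\frac{n_i}{n_i-n_j},\qquad \mathbb{U}_n[f(\hat p_{q})]=\binom{n}{q}^{-1}\sum_{\beta}f\Big(\frac1q\sum_{k\in\beta}X_k\Big),$$ where the last sum is over all $q$-element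 subsets $\beta$ of $\{1,\dots,n\}$. Theorem. For all integers $r\ge 1$, $s\ge 0$ and every $L>0$ there is a constant $C>0$, depending only on $r$, $s$ and $L$, such that for every $f$ satisfying condition $D_s$ with parameter $L$ and every integer $n\ge r$, $$\sup_{p\in[0,1]}\big|\mathbb{E}_p\hat f_r-f(p)\big|\le C\cdot\begin{cases} n^{r-s-1} & \text{if } 0\le s\le 2r-2,\\ n^{-(r-\frac12)} & \text{if } s=2r-1,\\ n^{-r} & \text{if } s\ge 2r.\end{cases}$$ -/

import Mathlib

open MeasureTheory ProbabilityTheory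

noncomputable section

namespace Jackknife

/-- Condition `D_s` with parameter `L` for a function on `[0,1]` (only the values of `f` on `[0,1]`
matter; derivatives at the endpoints are one-sided).

* `s = 0`: `f` is Lebesgue integrable on `[0,1]` and bounded by `L` there.
* `s = k + 1`: `f` has `k` derivatives on `[0,1]`, the `k`-th one is absolutely continuous on `[0,1]`,
  the derivatives of orders `0, …, k` are bounded by `L` on `[0,1]`, and the derivative of order
  `k + 1` is bounded by `L` at every point of `[0,1]` at which it exists (by absolute continuity it
  exists almost everywhere). Continuity of the `k`-th derivative, which is part of `ContDiffOn`,
  follows from its absolute continuity. -/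
def ConditionD (L : ℝ) (f : ℝ → ℝ) : ℕ → Prop
  | 0 => IntegrableOn f (Set.Icc 0 1) volume ∧ ∀ x ∈ Set.Icc (0 : ℝ) 1, |f x| ≤ L
  | k + 1 =>
      ContDiffOn ℝ k f (Set.Icc 0 1) ∧
      AbsolutelyContinuousOnInterval (iteratedDerivWithin k f (Set.Icc 0 1)) 0 1 ∧
      (∀ i ≤ k, ∀ x ∈ Set.Icc (0 : ℝ) 1, |iteratedDerivWithin i f (Set.Icc 0 1) x| ≤ L) ∧
      ∀ x ∈ Set.Icc (0 : ℝ) 1, ∀ d : ℝ,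
        HasDerivWithinAt (iteratedDerivWithin k f (Set.Icc 0 1)) d (Set.Icc 0 1) x → |d| ≤ L

/-- The law of `n` independent samples from the Bernoulli distribution `Bern(p)`
(`true` has probability `p`). -/
def sampleLaw (n : ℕ) (p : unitInterval) : Measure (Fin n → Bool) :=
  Measure.pi fun _ => bernoulliMeasure true false p

/-- The empirical frequency of `true` among `q` samples. -/
def empiricalFreq {q : ℕ} (x : Fin q → Bool) : ℝ :=
  (∑ k, if x k then (1 : ℝ) else 0) / q

/-- The `U`-statistic with kernel `g` of `q` arguments, based on the samples `X_1, …, X_n`: the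
average of `g` over all `q`-element subsets of the samples (listed in increasing order). -/
def uStatistic {n q : ℕ} (g : (Fin q → Bool) → ℝ) (X : Fin n → Bool) : ℝ :=
  (∑ β : {β : Finset (Fin n) // β.card = q},
    g fun k => X (β.1.orderEmbOfFin β.2 k)) / (n.choose q : ℝ)

/-- The jackknife coefficients `C_i = ∏_{j ≠ i} n_i / (n_i - n_j)` for sample sizes
`n_1, …, n_r`. -/
def coeff {r : ℕ} (N : Fin r → ℕ) (i : Fin r) : ℝ :=
  ∏ j ∈ Finset.univ.erase i, (N i : ℝ) / ((N i : ℝ) - (N j : ℝ))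

/-- The general `r`-jackknife estimator of `f(p)` with sample sizes `N`, based on `n` samples. -/
def estimator {r n : ℕ} (N : Fin r → ℕ) (f : ℝ → ℝ) (X : Fin n → Bool) : ℝ :=
  ∑ i, coeff N i * uStatistic (fun x : Fin (N i) → Bool => f (empiricalFreq x)) X

/-- The delete-1 sample sizes `n - r + 1, …, n - 1, n` (used for `r ≤ n`). -/
def deleteOneSizes (r n : ℕ) (i : Fin r) : ℕ := n + 1 + i - r

/-- The delete-1 `r`-jackknife estimator of `f(p)` based on `n` samples. -/
def deleteOne (r n : ℕ) (f : ℝ → ℝ) (X : Fin n → Bool) : ℝ :=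
  estimator (deleteOneSizes r n) f X

/-- The bias `E_p[f̂_r] - f(p)` of the delete-1 `r`-jackknife. -/
def deleteOneBias (r n : ℕ) (f : ℝ → ℝ) (p : unitInterval) : ℝ :=
  (∫ X, deleteOne r n f X ∂(sampleLaw n p)) - f p

end Jackknife

end

/-!
The expectation of the `U`-statistic with sample size `q` is the Bernstein operator
`E f(S_q / q)`, with `S_q` binomial, so the bias is `∑ C_i E f(S_{N_i} / N_i) - f(p)` with
`N_i = m + i`, `m = n - r + 1`. The weights `C_i` are of size `n^{r-1}`, but as a functional of
`u = 1 / N` the jackknife is Lagrange interpolation at `0`: it is exact on constants, annihilates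
`u, …, u^{r-1}`, and maps `u^a` to `O(m^{-a})` for every `a` (`jackSum_one`,
`jackSum_inv_pow_eq_zero`, `abs_jackSum_inv_pow_le`).

Write `S_{m+i} = S_m + Y_i` with `Y_i` an independent binomial variable with `i` trials, and put
`x = S_m / m`, `y = S_{m+i} / (m+i)`, so that `|y - x| = O(1/m)` with certainty. Then `f(y)` is the
sum of three parts (`IsTaylorSystem.abs_sub_sub_le`).

* The Taylor polynomial of `f` at `p`. Its mean is a polynomial in `1 / N_i`, so the jackknife
  leaves `f(p) + O(m^{-r})` (`exists_abs_jackSum_taylorPoly_sub_le`).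
* The Taylor polynomial at `x` of `f` minus the previous part. Its `l`-th coefficient is
  `O(|x - p|^{s-l})`, and `y - x = ((Y_i - i p) + i (p - x)) / (m + i)`. The central moments of
  `Y_i` of order `a` are polynomials in `i` of degree at most `a / 2`, so the jackknife turns this
  part into `O(m^{-s/2})` (`exists_abs_jackSum_increment_le`).
* A remainder `O(|y - x|^s) = O(m^{-s})`, for which the trivial bound on the weights gives
  `O(n^{r-1-s})` (`abs_jackSum_le`).

The three rates together give the theorem for `s ≤ 2 r`; a function of smoothness `s > 2 r` is
treated as one of smoothness `2 r` (`IsTaylorSystem.mono`).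
-/

namespace Jackknife

/-! ### The jackknife functional -/

section JackSum

variable {ι : Type*} [DecidableEq ι]

/-- The jackknife combination `∑ i ∈ S, C_i φ i` with `C_i = ∏_{j ∈ S, j ≠ i} N_i / (N_i - N_j)`,
for real sample sizes `N`. In terms of the nodes `u_i = 1 / N_i` it is the value at `0` of the
polynomial that interpolates `φ i` at `u_i`. -/
noncomputable def jackSum (S : Finset ι) (N : ι → ℝ) (φ : ι → ℝ) : ℝ :=
  ∑ i ∈ S, (∏ j ∈ S.erase i, N i / (N i - N j)) * φ i

lemma jackSum_add (S : Finset ι) (N φ ψ : ι → ℝ) :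
    jackSum S N (fun i => φ i + ψ i) = jackSum S N φ + jackSum S N ψ := by
  simp [jackSum, mul_add, Finset.sum_add_distrib]

lemma jackSum_const_mul (S : Finset ι) (N φ : ι → ℝ) (c : ℝ) :
    jackSum S N (fun i => c * φ i) = c * jackSum S N φ := by
  simp only [jackSum, Finset.mul_sum]
  exact Finset.sum_congr rfl fun i _ => by ring

lemma jackSum_sum {κ : Type*} (S : Finset ι) (N : ι → ℝ) (T : Finset κ) (φ : κ → ι → ℝ) :
    jackSum S N (fun i => ∑ t ∈ T, φ t i) = ∑ t ∈ T, jackSum S N (φ t) := by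
  simp only [jackSum, Finset.mul_sum]
  exact Finset.sum_comm

lemma jackSum_congr {S : Finset ι} {N φ ψ : ι → ℝ} (h : ∀ i ∈ S, φ i = ψ i) :
    jackSum S N φ = jackSum S N ψ :=
  Finset.sum_congr rfl fun i hi => by rw [h i hi]

/-- Multiplying by `u - u_v` removes the node `v`. -/
lemma jackSum_mul_inv_sub_inv {S : Finset ι} {N : ι → ℝ} (hinj : Set.InjOn N S)
    (h0 : ∀ i ∈ S, 0 < N i) {v : ι} (hv : v ∈ S) (φ : ι → ℝ) :
    jackSum S N (fun i => φ i * ((N i)⁻¹ - (N v)⁻¹)) = -(N v)⁻¹ * jackSum (S.erase v) N φ := by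
  rw [jackSum, jackSum, ← Finset.add_sum_erase _ _ hv, Finset.mul_sum]
  simp only [sub_self, mul_zero, zero_add]
  refine Finset.sum_congr rfl fun i hi => ?_
  obtain ⟨hiv, hiS⟩ := Finset.mem_erase.1 hi
  have hv' : v ∈ S.erase i := Finset.mem_erase.2 ⟨hiv.symm, hv⟩
  rw [← Finset.mul_prod_erase _ _ hv', Finset.erase_right_comm]
  have h1 : N i - N v ≠ 0 := sub_ne_zero.2 fun h => hiv (hinj hiS hv h)
  have h2 := (h0 i hiS).ne'
  have h3 := (h0 v hv).ne'
  field_simp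
  ring

lemma jackSum_inv_pow_succ {S : Finset ι} {N : ι → ℝ} (hinj : Set.InjOn N S)
    (h0 : ∀ i ∈ S, 0 < N i) {v : ι} (hv : v ∈ S) (a : ℕ) :
    jackSum S N (fun i => (N i)⁻¹ ^ (a + 1)) =
      (N v)⁻¹ * (jackSum S N (fun i => (N i)⁻¹ ^ a) -
        jackSum (S.erase v) N (fun i => (N i)⁻¹ ^ a)) := by
  have h := jackSum_mul_inv_sub_inv hinj h0 hv fun i => (N i)⁻¹ ^ a
  have h' : jackSum S N (fun i => (N i)⁻¹ ^ (a + 1)) =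
      jackSum S N (fun i => (N i)⁻¹ ^ a * ((N i)⁻¹ - (N v)⁻¹) + (N v)⁻¹ * (N i)⁻¹ ^ a) :=
    jackSum_congr fun i _ => by ring
  rw [h', jackSum_add, h, jackSum_const_mul]
  ring

lemma jackSum_one {S : Finset ι} {N : ι → ℝ} (hinj : Set.InjOn N S)
    (h0 : ∀ i ∈ S, 0 < N i) (hS : S.Nonempty) : jackSum S N (fun _ => 1) = 1 := by
  have hinj' : Set.InjOn (fun i => (N i)⁻¹) S := fun i hi j hj h => hinj hi hj (inv_injective h)
  have h := congrArg (Polynomial.eval 0) (Lagrange.sum_basis hinj' hS)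
  rw [Polynomial.eval_finsetSum, Polynomial.eval_one] at h
  refine Eq.trans ?_ h
  rw [jackSum]
  refine Finset.sum_congr rfl fun i hi => ?_
  rw [Lagrange.basis, Polynomial.eval_prod, mul_one]
  refine Finset.prod_congr rfl fun j hj => ?_
  obtain ⟨hji, hjS⟩ := Finset.mem_erase.1 hj
  have h1 : N i - N j ≠ 0 := sub_ne_zero.2 fun h => hji (hinj hi hjS h).symm
  have h1' : N j - N i ≠ 0 := sub_ne_zero.2 fun h => hji (hinj hi hjS h.symm).symm
  have h2 := (h0 i hi).ne'
  have h3 := (h0 j hjS).ne'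
  simp only [Lagrange.basisDivisor, Polynomial.eval_mul, Polynomial.eval_C, Polynomial.eval_sub,
    Polynomial.eval_X]
  have h4 : (N i)⁻¹ - (N j)⁻¹ = (N j - N i) / (N i * N j) := by field_simp
  rw [h4, inv_div, zero_sub]
  have h5 : N j - N i = -(N i - N j) := by ring
  rw [h5]
  field_simp

/-- The jackknife cancels the powers `N⁻¹, …, N^{-(r-1)}`. -/
lemma jackSum_inv_pow_eq_zero {N : ι → ℝ} (a : ℕ) : ∀ S : Finset ι, Set.InjOn N S →
    (∀ i ∈ S, 0 < N i) → a + 1 < S.card → jackSum S N (fun i => (N i)⁻¹ ^ (a + 1)) = 0 := by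
  induction a with
  | zero =>
    intro S hinj h0 hS
    obtain ⟨v, hv⟩ := Finset.card_pos.1 (by omega : 0 < S.card)
    have hc := Finset.card_erase_of_mem hv
    have hsub : S.erase v ⊆ S := Finset.erase_subset v S
    rw [jackSum_inv_pow_succ hinj h0 hv]
    simp only [pow_zero]
    rw [jackSum_one hinj h0 ⟨v, hv⟩,
      jackSum_one (hinj.mono (by exact_mod_cast hsub)) (fun i hi => h0 i (hsub hi))
        (Finset.card_pos.1 (by omega))]
    ring
  | succ a ih =>
    intro S hinj h0 hS
    obtain ⟨v, hv⟩ := Finset.card_pos.1 (by omega : 0 < S.card)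
    have hc := Finset.card_erase_of_mem hv
    have hsub : S.erase v ⊆ S := Finset.erase_subset v S
    rw [jackSum_inv_pow_succ hinj h0 hv, ih S hinj h0 (by omega),
      ih _ (hinj.mono (by exact_mod_cast hsub)) (fun i hi => h0 i (hsub hi)) (by omega)]
    ring

lemma abs_jackSum_inv_pow_le {N : ι → ℝ} {m : ℝ} (hm : 0 < m) (a : ℕ) : ∀ S : Finset ι,
    Set.InjOn N S → (∀ i ∈ S, m ≤ N i) →
      |jackSum S N (fun i => (N i)⁻¹ ^ a)| ≤ 2 ^ a * m⁻¹ ^ a := by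
  induction a with
  | zero =>
    intro S hinj h0
    rcases S.eq_empty_or_nonempty with rfl | hS
    · simp [jackSum]
    · simp only [pow_zero]
      rw [jackSum_one hinj (fun i hi => hm.trans_le (h0 i hi)) hS]
      simp
  | succ a ih =>
    intro S hinj h0
    rcases S.eq_empty_or_nonempty with rfl | ⟨v, hv⟩
    · simp only [jackSum, Finset.sum_empty, abs_zero]
      positivity
    have hsub : S.erase v ⊆ S := Finset.erase_subset v S
    rw [jackSum_inv_pow_succ hinj (fun i hi => hm.trans_le (h0 i hi)) hv, abs_mul]
    have h1 := ih S hinj h0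
    have h2 := ih _ (hinj.mono (by exact_mod_cast hsub)) (fun i hi => h0 i (hsub hi))
    have h3 : |(N v)⁻¹| ≤ m⁻¹ := by
      rw [abs_of_pos (inv_pos.2 (hm.trans_le (h0 v hv)))]
      exact inv_anti₀ hm (h0 v hv)
    calc _ ≤ m⁻¹ * (2 ^ a * m⁻¹ ^ a + 2 ^ a * m⁻¹ ^ a) := by
          refine mul_le_mul h3 ((abs_sub _ _).trans (add_le_add h1 h2)) (abs_nonneg _)
            (inv_pos.2 hm).le
      _ = _ := by ring

/-- With `N_i = m + t_i`, the jackknife of `t_i ^ c / N_i ^ l` is `O(m^{c-l})`, whatever the number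
of nodes: expand `t_i ^ c = (N_i - m) ^ c`. The trivial bound would lose the size of the weights. -/
lemma abs_jackSum_pow_mul_inv_pow_le {N t : ι → ℝ} {m : ℝ} (hm : 0 < m) {S : Finset ι}
    (hinj : Set.InjOn N S) (hN : ∀ i ∈ S, N i = m + t i) (ht : ∀ i ∈ S, 0 ≤ t i) {c l : ℕ}
    (hcl : c ≤ l) :
    |jackSum S N (fun i => t i ^ c * (N i)⁻¹ ^ l)| ≤ 2 ^ c * 2 ^ l * m⁻¹ ^ (l - c) := by
  have hN' : ∀ i ∈ S, m ≤ N i := fun i hi => by linarith [hN i hi, ht i hi]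
  have h1 : jackSum S N (fun i => t i ^ c * (N i)⁻¹ ^ l) =
      ∑ e ∈ Finset.range (c + 1), ((-m) ^ (c - e) * (c.choose e : ℝ)) *
        jackSum S N (fun i => (N i)⁻¹ ^ (l - e)) := by
    simp_rw [← jackSum_const_mul]
    rw [← jackSum_sum]
    refine jackSum_congr fun i hi => ?_
    have hpos : N i ≠ 0 := (hm.trans_le (hN' i hi)).ne'
    have h2 : t i = N i + -m := by linarith [hN i hi]
    rw [h2, add_pow, Finset.sum_mul]
    refine Finset.sum_congr rfl fun e he => ?_
    have hel : e ≤ l := by have := Finset.mem_range.1 he; omega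
    have h3 : (N i) ^ e * (N i)⁻¹ ^ l = (N i)⁻¹ ^ (l - e) := by
      rw [← Nat.add_sub_of_le hel, pow_add, Nat.add_sub_cancel_left, ← mul_assoc, ← mul_pow,
        mul_inv_cancel₀ hpos, one_pow, one_mul]
    rw [← h3]
    ring
  rw [h1]
  calc _ ≤ ∑ e ∈ Finset.range (c + 1), (c.choose e : ℝ) * (2 ^ l * m⁻¹ ^ (l - c)) := by
        refine (Finset.abs_sum_le_sum_abs _ _).trans (Finset.sum_le_sum fun e he => ?_)
        have hec : e ≤ c := by have := Finset.mem_range.1 he; omega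
        have h2 := abs_jackSum_inv_pow_le hm (l - e) S hinj hN'
        have h3 : m ^ (c - e) * m⁻¹ ^ (l - e) = m⁻¹ ^ (l - c) := by
          have : l - e = (c - e) + (l - c) := by omega
          rw [this, pow_add, ← mul_assoc, ← mul_pow, mul_inv_cancel₀ hm.ne', one_pow, one_mul]
        rw [abs_mul, abs_mul, abs_pow, abs_neg, abs_of_pos hm, Nat.abs_cast]
        calc _ ≤ m ^ (c - e) * (c.choose e : ℝ) * (2 ^ (l - e) * m⁻¹ ^ (l - e)) := by gcongr
          _ = (c.choose e : ℝ) * (2 ^ (l - e) * (m ^ (c - e) * m⁻¹ ^ (l - e))) := by ring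
          _ ≤ _ := by
            rw [h3]
            gcongr
            · norm_num
            · omega
    _ = 2 ^ c * 2 ^ l * m⁻¹ ^ (l - c) := by
        rw [← Finset.sum_mul]
        have := Nat.sum_range_choose c
        have h4 : ∑ e ∈ Finset.range (c + 1), (c.choose e : ℝ) = 2 ^ c := by exact_mod_cast this
        rw [h4]
        ring

end JackSum

/-! ### Binomial expectations and their central moments -/

/-- The expectation of `φ(S_q)`, where `S_q` is binomial with parameters `q` and `p`, defined by
conditioning on one of the trials. -/
noncomputable def binomMean (p : ℝ) : ℕ → (ℕ → ℝ) → ℝ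
  | 0, φ => φ 0
  | q + 1, φ => (1 - p) * binomMean p q φ + p * binomMean p q fun k => φ (k + 1)

section BinomMean

variable {p : ℝ}

lemma binomMean_const_mul (c : ℝ) (q : ℕ) : ∀ φ : ℕ → ℝ,
    binomMean p q (fun k => c * φ k) = c * binomMean p q φ := by
  induction q with
  | zero => intro φ; rfl
  | succ q ih =>
    intro φ
    simp only [binomMean, ih]
    ring

lemma binomMean_sum {κ : Type*} (T : Finset κ) (q : ℕ) : ∀ φ : κ → ℕ → ℝ,
    binomMean p q (fun k => ∑ t ∈ T, φ t k) = ∑ t ∈ T, binomMean p q (φ t) := by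
  induction q with
  | zero => intro φ; rfl
  | succ q ih =>
    intro φ
    simp only [binomMean, ih, Finset.mul_sum, ← Finset.sum_add_distrib]

lemma binomMean_add (q : ℕ) : ∀ φ ψ : ℕ → ℝ,
    binomMean p q (fun k => φ k + ψ k) = binomMean p q φ + binomMean p q ψ := by
  induction q with
  | zero => intro φ ψ; rfl
  | succ q ih =>
    intro φ ψ
    simp only [binomMean, ih]
    ring

lemma binomMean_const (c : ℝ) (q : ℕ) : binomMean p q (fun _ => c) = c := by
  induction q with
  | zero => rfl
  | succ q ih =>
    simp only [binomMean, ih]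
    ring

lemma binomMean_mono (hp : p ∈ Set.Icc (0 : ℝ) 1) (q : ℕ) : ∀ φ ψ : ℕ → ℝ,
    (∀ k ≤ q, φ k ≤ ψ k) → binomMean p q φ ≤ binomMean p q ψ := by
  induction q with
  | zero => exact fun φ ψ h => h 0 le_rfl
  | succ q ih =>
    intro φ ψ h
    have h1 := ih φ ψ fun k hk => h k (by omega)
    have h2 := ih (fun k => φ (k + 1)) (fun k => ψ (k + 1)) fun k hk => h (k + 1) (by omega)
    exact add_le_add (mul_le_mul_of_nonneg_left h1 (by linarith [hp.2]))
      (mul_le_mul_of_nonneg_left h2 hp.1)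

lemma binomMean_congr {q : ℕ} : ∀ {φ ψ : ℕ → ℝ},
    (∀ k ≤ q, φ k = ψ k) → binomMean p q φ = binomMean p q ψ := by
  induction q with
  | zero => exact fun h => h 0 le_rfl
  | succ q ih =>
    intro φ ψ h
    simp only [binomMean]
    rw [ih fun k hk => h k (by omega), ih fun k hk => h (k + 1) (by omega)]

lemma abs_binomMean_le (hp : p ∈ Set.Icc (0 : ℝ) 1) {q : ℕ} {φ ψ : ℕ → ℝ}
    (h : ∀ k ≤ q, |φ k| ≤ ψ k) : |binomMean p q φ| ≤ binomMean p q ψ := by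
  refine abs_le.2 ⟨?_, binomMean_mono hp q φ ψ fun k hk => (abs_le.1 (h k hk)).2⟩
  have h1 := binomMean_mono hp q (fun k => -1 * ψ k) φ fun k hk => by
    linarith [(abs_le.1 (h k hk)).1]
  rw [binomMean_const_mul] at h1
  linarith

lemma binomMean_add_trials (m i : ℕ) : ∀ φ : ℕ → ℝ,
    binomMean p (m + i) φ = binomMean p m fun k => binomMean p i fun h => φ (k + h) := by
  induction i with
  | zero => intro φ; rfl
  | succ i ih =>
    intro φ
    rw [← add_assoc]
    simp only [binomMean]
    rw [ih, ih, binomMean_add, binomMean_const_mul, binomMean_const_mul]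
    rfl

/-- The `a`-th central moment of the binomial distribution with `q` trials. -/
noncomputable def centralMoment (p : ℝ) (a q : ℕ) : ℝ :=
  binomMean p q fun k => ((k : ℝ) - q * p) ^ a

/-- The `b`-th central moment of a Bernoulli variable. -/
noncomputable def bernoulliMoment (p : ℝ) (b : ℕ) : ℝ := (1 - p) * (-p) ^ b + p * (1 - p) ^ b

lemma abs_bernoulliMoment_le (hp : p ∈ Set.Icc (0 : ℝ) 1) (b : ℕ) : |bernoulliMoment p b| ≤ 1 := by
  obtain ⟨h0, h1⟩ := hp
  have h2 : |(1 - p) * (-p) ^ b| ≤ 1 - p := by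
    rw [abs_mul, abs_pow, abs_neg, abs_of_nonneg h0, abs_of_nonneg (by linarith : 0 ≤ 1 - p)]
    exact mul_le_of_le_one_right (by linarith) (pow_le_one₀ h0 h1)
  have h3 : |p * (1 - p) ^ b| ≤ p := by
    rw [abs_mul, abs_pow, abs_of_nonneg h0, abs_of_nonneg (by linarith : 0 ≤ 1 - p)]
    exact mul_le_of_le_one_right h0 (pow_le_one₀ (by linarith) (by linarith))
  calc _ ≤ _ := abs_add_le _ _
    _ ≤ (1 - p) + p := add_le_add h2 h3
    _ = 1 := by ring

lemma centralMoment_succ (a q : ℕ) : centralMoment p a (q + 1) =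
    ∑ b ∈ Finset.range (a + 1), (a.choose b : ℝ) * bernoulliMoment p b *
      centralMoment p (a - b) q := by
  have key : ∀ c : ℝ, binomMean p q (fun k => (c + ((k : ℝ) - q * p)) ^ a) =
      ∑ b ∈ Finset.range (a + 1), c ^ b * (a.choose b : ℝ) * centralMoment p (a - b) q := by
    intro c
    simp only [centralMoment, ← binomMean_const_mul]
    rw [← binomMean_sum]
    refine binomMean_congr fun k _ => ?_
    rw [add_pow]
    exact Finset.sum_congr rfl fun b _ => by ring
  have h1 := key (-p)
  have h2 := key (1 - p)
  have e1 : ∀ k : ℕ, (k : ℝ) - (q + 1 : ℕ) * p = -p + (k - q * p) := fun k => by push_cast; ring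
  have e2 : ∀ k : ℕ, ((k + 1 : ℕ) : ℝ) - (q + 1 : ℕ) * p = (1 - p) + (k - q * p) :=
    fun k => by push_cast; ring
  rw [centralMoment]
  simp only [binomMean, e2, e1]
  rw [h1, h2, Finset.mul_sum, Finset.mul_sum, ← Finset.sum_add_distrib]
  exact Finset.sum_congr rfl fun b _ => by rw [bernoulliMoment]; ring

/-- The coefficient of `q.choose c` in the `a`-th central moment of `q` trials. -/
noncomputable def momentCoeff (p : ℝ) : ℕ → ℕ → ℝ
  | 0, a => if a = 0 then 1 else 0
  | c + 1, a => ∑ b ∈ Finset.range (a - 1), (a.choose (b + 2) : ℝ) * bernoulliMoment p (b + 2) *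
      momentCoeff p c (a - (b + 2))

lemma momentCoeff_eq_zero (c : ℕ) : ∀ a, a < 2 * c → momentCoeff p c a = 0 := by
  induction c with
  | zero => intro a h; omega
  | succ c ih =>
    intro a h
    refine Finset.sum_eq_zero fun b hb => ?_
    rw [ih _ (by have := Finset.mem_range.1 hb; omega), mul_zero]

lemma exists_abs_momentCoeff_le (c : ℕ) : ∀ a, ∃ K : ℝ, ∀ p ∈ Set.Icc (0 : ℝ) 1,
    |momentCoeff p c a| ≤ K := by
  induction c with
  | zero =>
    refine fun a => ⟨1, fun p _ => ?_⟩
    simp only [momentCoeff]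
    split_ifs <;> simp
  | succ c ih =>
    intro a
    choose K hK using ih
    refine ⟨∑ b ∈ Finset.range (a - 1), (a.choose (b + 2) : ℝ) * 1 * K (a - (b + 2)),
      fun p hp => (Finset.abs_sum_le_sum_abs _ _).trans (Finset.sum_le_sum fun b _ => ?_)⟩
    rw [abs_mul, abs_mul, Nat.abs_cast]
    exact mul_le_mul (mul_le_mul_of_nonneg_left (abs_bernoulliMoment_le hp _) (Nat.cast_nonneg _))
      (hK _ p hp) (abs_nonneg _) (by positivity)

lemma centralMoment_succ_eq_add (a q : ℕ) : centralMoment p a (q + 1) = centralMoment p a q +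
    ∑ b ∈ Finset.range (a - 1), (a.choose (b + 2) : ℝ) * bernoulliMoment p (b + 2) *
      centralMoment p (a - (b + 2)) q := by
  have h0 : bernoulliMoment p 0 = 1 := by simp [bernoulliMoment]
  have h1 : bernoulliMoment p 1 = 0 := by simp only [bernoulliMoment]; ring
  rw [centralMoment_succ]
  rcases a with _ | _ | a
  · simp [h0]
  · simp [Finset.sum_range_succ, h0, h1]
  · rw [Finset.sum_range_succ', Finset.sum_range_succ']
    simp only [zero_add, h0, h1, Nat.choose_zero_right, Nat.cast_one, mul_one, one_mul,
      mul_zero, zero_mul, add_zero, tsub_zero, Nat.add_sub_cancel]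
    exact add_comm _ _

lemma centralMoment_eq_sum_choose (M q : ℕ) : ∀ a, a < 2 * (M + 1) → centralMoment p a q =
    ∑ c ∈ Finset.range (M + 1), momentCoeff p c a * (q.choose c : ℝ) := by
  induction q with
  | zero =>
    intro a _
    rw [Finset.sum_range_succ']
    simp only [centralMoment, binomMean, momentCoeff]
    rcases a with _ | a <;> simp
  | succ q ih =>
    intro a ha
    have h1 : ∑ b ∈ Finset.range (a - 1), (a.choose (b + 2) : ℝ) * bernoulliMoment p (b + 2) *
        centralMoment p (a - (b + 2)) q =
        ∑ c ∈ Finset.range (M + 1), momentCoeff p (c + 1) a * (q.choose c : ℝ) := by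
      simp only [momentCoeff, Finset.sum_mul]
      rw [Finset.sum_comm]
      refine Finset.sum_congr rfl fun b _ => ?_
      rw [ih _ (by omega), Finset.mul_sum]
      exact Finset.sum_congr rfl fun c _ => by ring
    rw [centralMoment_succ_eq_add, h1, ih a ha, Finset.sum_range_succ',
      Finset.sum_range_succ (fun c => momentCoeff p (c + 1) a * (q.choose c : ℝ)),
      momentCoeff_eq_zero (M + 1) a ha, Finset.sum_range_succ']
    simp only [Nat.choose_succ_succ, Nat.cast_add, mul_add, Finset.sum_add_distrib]
    simp
    ring

lemma exists_choose_eq_sum_pow (c : ℕ) : ∃ σ : ℕ → ℝ, ∀ q : ℕ,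
    (q.choose c : ℝ) = ∑ e ∈ Finset.range (c + 1), σ e * (q : ℝ) ^ e := by
  refine ⟨fun e => (descPochhammer ℝ c).coeff e / c.factorial, fun q => ?_⟩
  rw [Nat.cast_choose_eq_descPochhammer_div, Polynomial.eval_eq_sum_range,
    descPochhammer_natDegree, Finset.sum_div]
  exact Finset.sum_congr rfl fun e _ => by ring

/-- The `a`-th central moment of a binomial variable is a polynomial of degree at most `a / 2` in
the number of trials, with coefficients bounded uniformly in `p`. -/
lemma exists_centralMoment_eq_sum_pow (a : ℕ) : ∃ K : ℝ, 0 ≤ K ∧ ∀ p ∈ Set.Icc (0 : ℝ) 1,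
    ∃ τ : ℕ → ℝ, (∀ e, |τ e| ≤ K) ∧
      ∀ q : ℕ, centralMoment p a q = ∑ e ∈ Finset.range (a / 2 + 1), τ e * (q : ℝ) ^ e := by
  choose σ hσ using exists_choose_eq_sum_pow
  choose K hK using fun c => exists_abs_momentCoeff_le c a
  have hK0 : ∀ c, 0 ≤ K c := fun c => (abs_nonneg _).trans (hK c 0 ⟨le_rfl, zero_le_one⟩)
  refine ⟨∑ e ∈ Finset.range (a / 2 + 1), ∑ c ∈ Finset.range (a / 2 + 1), K c * |σ c e|,
    Finset.sum_nonneg fun e _ => Finset.sum_nonneg fun c _ => mul_nonneg (hK0 c) (abs_nonneg _),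
    fun p hp => ⟨fun e => if e ∈ Finset.range (a / 2 + 1) then
      ∑ c ∈ Finset.range (a / 2 + 1), (if e ≤ c then momentCoeff p c a * σ c e else 0) else 0,
      fun e => ?_, fun q => ?_⟩⟩
  · dsimp only
    split_ifs with he
    · calc _ ≤ ∑ c ∈ Finset.range (a / 2 + 1), K c * |σ c e| := by
            refine (Finset.abs_sum_le_sum_abs _ _).trans (Finset.sum_le_sum fun c _ => ?_)
            split_ifs
            · rw [abs_mul]
              exact mul_le_mul_of_nonneg_right (hK c p hp) (abs_nonneg _)
            · rw [abs_zero]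
              have := hK0 c
              positivity
        _ ≤ _ := Finset.single_le_sum
            (f := fun e => ∑ c ∈ Finset.range (a / 2 + 1), K c * |σ c e|)
            (fun e _ => Finset.sum_nonneg fun c _ => mul_nonneg (hK0 c) (abs_nonneg _)) he
    · rw [abs_zero]
      exact Finset.sum_nonneg fun e _ => Finset.sum_nonneg fun c _ =>
        mul_nonneg (hK0 c) (abs_nonneg _)
  · rw [centralMoment_eq_sum_choose (a / 2) q a (by omega)]
    have h1 : ∀ c ∈ Finset.range (a / 2 + 1), momentCoeff p c a * (q.choose c : ℝ) =
        ∑ e ∈ Finset.range (a / 2 + 1),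
          (if e ≤ c then momentCoeff p c a * σ c e else 0) * (q : ℝ) ^ e := by
      intro c hc
      rw [hσ, Finset.mul_sum]
      have hsub : Finset.range (c + 1) ⊆ Finset.range (a / 2 + 1) :=
        Finset.range_subset_range.2 (by have := Finset.mem_range.1 hc; omega)
      rw [← Finset.sum_subset hsub]
      · refine Finset.sum_congr rfl fun e he => ?_
        rw [if_pos (by have := Finset.mem_range.1 he; omega)]
        ring
      · intro e _ he
        rw [if_neg (by rw [Finset.mem_range] at he; omega), zero_mul]
    rw [Finset.sum_congr rfl h1, Finset.sum_comm]
    refine Finset.sum_congr rfl fun e he => ?_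
    dsimp only
    rw [if_pos he, Finset.sum_mul]

/-- Absolute central moments: `E|S_m/m - p|^k = O(m^{-k/2})`. -/
lemma exists_binomMean_abs_pow_le (k : ℕ) : ∃ K : ℝ, 0 ≤ K ∧ ∀ p ∈ Set.Icc (0 : ℝ) 1, ∀ m : ℕ,
    0 < m → binomMean p m (fun j => |(j : ℝ) / m - p| ^ k) ≤ K * (√m)⁻¹ ^ k := by
  obtain ⟨K, hK0, hK⟩ := exists_centralMoment_eq_sum_pow (2 * k)
  refine ⟨1 + (k + 1) * K, by positivity, fun p hp m hm => ?_⟩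
  obtain ⟨τ, hτ, hμ⟩ := hK p hp
  have hm1 : (1 : ℝ) ≤ m := by exact_mod_cast hm
  have hw : 0 < √(m : ℝ) := Real.sqrt_pos.2 (by linarith)
  have hw2 : √(m : ℝ) ^ 2 = m := Real.sq_sqrt (by linarith)
  have h1 : centralMoment p (2 * k) m ≤ (k + 1) * K * (m : ℝ) ^ k := by
    rw [hμ, show 2 * k / 2 = k by omega]
    calc _ ≤ ∑ e ∈ Finset.range (k + 1), K * (m : ℝ) ^ k := by
          refine Finset.sum_le_sum fun e he => ?_
          refine (mul_le_mul_of_nonneg_right ((le_abs_self _).trans (hτ e)) (by positivity)).trans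
            (mul_le_mul_of_nonneg_left (pow_le_pow_right₀ hm1 ?_) hK0)
          have := Finset.mem_range.1 he; omega
      _ = _ := by simp; ring
  -- with `z = (j - m p) / √m`, the elementary bound `|z| ^ k ≤ 1 + z ^ (2 k)` is enough
  calc _ ≤ binomMean p m (fun j => (√m)⁻¹ ^ k *
          (1 + (m : ℝ)⁻¹ ^ k * ((j : ℝ) - m * p) ^ (2 * k))) := by
        refine binomMean_mono hp m _ _ fun j _ => ?_
        set z : ℝ := (√m)⁻¹ * ((j : ℝ) - m * p) with hz
        have e1 : (j : ℝ) / m - p = (√m)⁻¹ * z := by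
          rw [hz, ← mul_assoc, ← mul_inv, ← sq, hw2]
          field_simp
        have e2 : (m : ℝ)⁻¹ ^ k * ((j : ℝ) - m * p) ^ (2 * k) = (|z| ^ k) ^ 2 := by
          rw [← pow_mul, mul_comm k 2, pow_mul |z|, sq_abs, hz, mul_pow, inv_pow √(m : ℝ), hw2,
            mul_pow, ← pow_mul]
        rw [e1, e2, abs_mul, mul_pow, abs_of_pos (inv_pos.2 hw)]
        refine mul_le_mul_of_nonneg_left ?_ (by positivity)
        nlinarith [sq_nonneg (|z| ^ k - 1), sq_nonneg (|z| ^ k)]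
    _ = (√m)⁻¹ ^ k * (1 + (m : ℝ)⁻¹ ^ k * centralMoment p (2 * k) m) := by
        rw [binomMean_const_mul, binomMean_add, binomMean_const, binomMean_const_mul]
        rfl
    _ ≤ (√m)⁻¹ ^ k * (1 + (m : ℝ)⁻¹ ^ k * ((k + 1) * K * (m : ℝ) ^ k)) := by gcongr
    _ = _ := by
        have : (m : ℝ)⁻¹ ^ k * (m : ℝ) ^ k = 1 := by
          rw [← mul_pow, inv_mul_cancel₀ (by linarith), one_pow]
        linear_combination (√m)⁻¹ ^ k * (k + 1) * K * this

end BinomMean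

/-! ### Central moments under the jackknife -/

section Moments

variable {ι : Type*} [DecidableEq ι]

/-- The jackknife of the mean of `(Y_i - i p) ^ a * i ^ b / (m + i) ^ (a + b)`, where `Y_i` is the
number of successes in the `i` additional trials: the mean of the numerator is a polynomial in `i`
of degree at most `a / 2 + b`, whence the bound `O(m^{-a/2})`, however many nodes there are. -/
lemma exists_abs_jackSum_centralMoment_le (a b : ℕ) : ∃ K : ℝ, 0 ≤ K ∧
    ∀ p ∈ Set.Icc (0 : ℝ) 1, ∀ (S : Finset ι) (m : ℕ) (t : ι → ℕ), 0 < m → Set.InjOn t S →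
      |jackSum S (fun i => ((m + t i : ℕ) : ℝ)) (fun i => centralMoment p a (t i) * (t i : ℝ) ^ b *
        ((m + t i : ℕ) : ℝ)⁻¹ ^ (a + b))| ≤ K * (√m)⁻¹ ^ a := by
  obtain ⟨K, hK0, hK⟩ := exists_centralMoment_eq_sum_pow a
  refine ⟨∑ e ∈ Finset.range (a / 2 + 1), K * (2 ^ (e + b) * 2 ^ (a + b)), by positivity,
    fun p hp S m t hm ht => ?_⟩
  obtain ⟨τ, hτ, hμ⟩ := hK p hp
  have hm1 : (1 : ℝ) ≤ m := by exact_mod_cast hm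
  have hm0 : (0 : ℝ) < m := by linarith
  have hw1 : 1 ≤ √(m : ℝ) := Real.one_le_sqrt.2 hm1
  have hw2 : √(m : ℝ) ^ 2 = m := Real.sq_sqrt (by linarith)
  have hinj : Set.InjOn (fun i => ((m + t i : ℕ) : ℝ)) S := fun i hi j hj h =>
    ht hi hj (by simpa using h)
  have h1 : jackSum S (fun i => ((m + t i : ℕ) : ℝ)) (fun i => centralMoment p a (t i) *
      (t i : ℝ) ^ b * ((m + t i : ℕ) : ℝ)⁻¹ ^ (a + b)) =
      ∑ e ∈ Finset.range (a / 2 + 1), τ e * jackSum S (fun i => ((m + t i : ℕ) : ℝ))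
        (fun i => (t i : ℝ) ^ (e + b) * ((m + t i : ℕ) : ℝ)⁻¹ ^ (a + b)) := by
    simp_rw [← jackSum_const_mul]
    rw [← jackSum_sum]
    refine jackSum_congr fun i _ => ?_
    rw [hμ, Finset.sum_mul, Finset.sum_mul]
    exact Finset.sum_congr rfl fun e _ => by ring
  rw [h1, Finset.sum_mul]
  refine (Finset.abs_sum_le_sum_abs _ _).trans (Finset.sum_le_sum fun e he => ?_)
  have hea : 2 * e ≤ a := by have := Finset.mem_range.1 he; omega
  have h2 := abs_jackSum_pow_mul_inv_pow_le hm0 hinj (t := fun i => (t i : ℝ))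
    (fun i _ => by push_cast; ring) (fun i _ => Nat.cast_nonneg _)
    (by omega : e + b ≤ a + b)
  have h3 : (m : ℝ)⁻¹ ^ (a + b - (e + b)) ≤ (√m)⁻¹ ^ a := by
    have h4 : (m : ℝ)⁻¹ = (√m)⁻¹ ^ 2 := by rw [inv_pow, hw2]
    rw [h4, ← pow_mul]
    exact pow_le_pow_of_le_one (by positivity) (inv_le_one_of_one_le₀ hw1) (by omega)
  rw [abs_mul, mul_assoc]
  refine mul_le_mul (hτ e) (h2.trans ?_) (abs_nonneg _) hK0
  gcongr

/-- The jackknife of the `d`-th central moment of the empirical frequency, for `d ≥ 1`: the moment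
is a polynomial without constant term in `N⁻¹`, and the powers below `N^{-r}` cancel. -/
lemma exists_abs_jackSum_centralMoment_freq_le {d : ℕ} (hd : 0 < d) (r : ℕ) : ∃ K : ℝ, 0 ≤ K ∧
    ∀ p ∈ Set.Icc (0 : ℝ) 1, ∀ (S : Finset ι) (m : ℕ) (t : ι → ℕ), S.card = r → 0 < m →
      Set.InjOn t S →
      |jackSum S (fun i => ((m + t i : ℕ) : ℝ)) (fun i => centralMoment p d (m + t i) *
        ((m + t i : ℕ) : ℝ)⁻¹ ^ d)| ≤ K * (m : ℝ)⁻¹ ^ r := by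
  obtain ⟨K, hK0, hK⟩ := exists_centralMoment_eq_sum_pow d
  refine ⟨∑ e ∈ Finset.range (d / 2 + 1), K * 2 ^ (d - e), by positivity,
    fun p hp S m t hS hm ht => ?_⟩
  obtain ⟨τ, hτ, hμ⟩ := hK p hp
  have hm1 : (1 : ℝ) ≤ m := by exact_mod_cast hm
  have hm0 : (0 : ℝ) < m := by linarith
  have hinj : Set.InjOn (fun i => ((m + t i : ℕ) : ℝ)) S := fun i hi j hj h =>
    ht hi hj (by simpa using h)
  have hpos : ∀ i, (0 : ℝ) < ((m + t i : ℕ) : ℝ) := fun i => by positivity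
  have h1 : jackSum S (fun i => ((m + t i : ℕ) : ℝ)) (fun i => centralMoment p d (m + t i) *
      ((m + t i : ℕ) : ℝ)⁻¹ ^ d) =
      ∑ e ∈ Finset.range (d / 2 + 1), τ e * jackSum S (fun i => ((m + t i : ℕ) : ℝ))
        (fun i => ((m + t i : ℕ) : ℝ)⁻¹ ^ (d - e)) := by
    simp_rw [← jackSum_const_mul]
    rw [← jackSum_sum]
    refine jackSum_congr fun i _ => ?_
    rw [hμ, Finset.sum_mul]
    refine Finset.sum_congr rfl fun e he => ?_
    have hed : e ≤ d := by have := Finset.mem_range.1 he; omega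
    have h3 : ((m + t i : ℕ) : ℝ) ^ e * ((m + t i : ℕ) : ℝ)⁻¹ ^ d =
        ((m + t i : ℕ) : ℝ)⁻¹ ^ (d - e) := by
      rw [← Nat.add_sub_of_le hed, pow_add, Nat.add_sub_cancel_left, ← mul_assoc, ← mul_pow,
        mul_inv_cancel₀ (hpos i).ne', one_pow, one_mul]
    rw [← h3]
    ring
  rw [h1, Finset.sum_mul]
  refine (Finset.abs_sum_le_sum_abs _ _).trans (Finset.sum_le_sum fun e he => ?_)
  have hed : e < d := by have := Finset.mem_range.1 he; omega
  rw [abs_mul, mul_assoc]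
  refine mul_le_mul (hτ e) ?_ (abs_nonneg _) hK0
  rcases lt_or_ge (d - e) r with h | h
  · obtain ⟨c, hc⟩ : ∃ c, d - e = c + 1 := ⟨d - e - 1, by omega⟩
    rw [hc, jackSum_inv_pow_eq_zero c S hinj (fun i _ => hpos i) (by omega), abs_zero]
    positivity
  · refine (abs_jackSum_inv_pow_le hm0 (d - e) S hinj fun i _ => by push_cast; simp).trans ?_
    exact mul_le_mul_of_nonneg_left (pow_le_pow_of_le_one (by positivity)
      (inv_le_one_of_one_le₀ hm1) h) (by positivity)

end Moments

/-! ### Taylor expansion under condition `D_s` -/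

/-- `F 0, F 1, …` behave like the derivatives of `F 0` on `[0,1]` up to order `s`: those of order
below `s` are bounded by `M`, and the Taylor polynomials of degree below `s` have remainders
bounded by `M` times the right power of the distance. For `s = 0` this says that `F 0` is bounded;
the functions `F l` with `0 < s ≤ l` are irrelevant. -/
def IsTaylorSystem (M : ℝ) (s : ℕ) (F : ℕ → ℝ → ℝ) : Prop :=
  (∀ l < s, ∀ x ∈ Set.Icc (0 : ℝ) 1, |F l x| ≤ M) ∧
  ∀ l, (l = 0 ∨ l < s) → ∀ x ∈ Set.Icc (0 : ℝ) 1, ∀ y ∈ Set.Icc (0 : ℝ) 1,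
    |F l y - ∑ e ∈ Finset.range (s - l), F (l + e) x * ((y - x) ^ e / (e.factorial : ℝ))| ≤
      M * |y - x| ^ (s - l)

/-- An absolutely continuous function whose derivative is bounded by `L` wherever it exists is
`L`-Lipschitz. -/
lemma abs_sub_le_of_absolutelyContinuous {g : ℝ → ℝ} {L : ℝ} (hL : 0 ≤ L)
    (hg : AbsolutelyContinuousOnInterval g 0 1)
    (hd : ∀ x ∈ Set.Icc (0 : ℝ) 1, ∀ d : ℝ, HasDerivWithinAt g d (Set.Icc 0 1) x → |d| ≤ L)
    {x y : ℝ} (hx : x ∈ Set.Icc (0 : ℝ) 1) (hy : y ∈ Set.Icc (0 : ℝ) 1) :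
    |g y - g x| ≤ L * |y - x| := by
  have hsub : Set.uIcc x y ⊆ Set.Icc 0 1 := Set.uIcc_subset_Icc hx hy
  have hac : AbsolutelyContinuousOnInterval g x y :=
    hg.mono (by rwa [Set.uIcc_of_le (zero_le_one' ℝ)])
  rw [← hac.integral_deriv_eq_sub]
  rw [← Real.norm_eq_abs]
  refine intervalIntegral.norm_integral_le_of_norm_le_const fun t ht => ?_
  by_cases h : DifferentiableAt ℝ g t
  · exact hd t (hsub (Set.uIoc_subset_uIcc ht)) _ h.hasDerivAt.hasDerivWithinAt
  · rw [deriv_zero_of_not_differentiableAt h]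
    simpa using hL

lemma hasDerivAt_taylorSum (c : ℕ → ℝ) (x y : ℝ) (n : ℕ) :
    HasDerivAt (fun z => ∑ e ∈ Finset.range (n + 1), c e * ((z - x) ^ e / (e.factorial : ℝ)))
      (∑ e ∈ Finset.range n, c (e + 1) * ((y - x) ^ e / (e.factorial : ℝ))) y := by
  simp only [Finset.sum_range_succ' _ n]
  have h : ∀ e ∈ Finset.range n,
      HasDerivAt (fun z => c (e + 1) * ((z - x) ^ (e + 1) / ((e + 1).factorial : ℝ)))
        (c (e + 1) * ((y - x) ^ e / (e.factorial : ℝ))) y := by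
    intro e _
    have h1 := ((((hasDerivAt_id y).sub_const x).pow (e + 1)).div_const
      ((e + 1).factorial : ℝ)).const_mul (c (e + 1))
    refine h1.congr_deriv ?_
    rw [Nat.factorial_succ]
    have h2 : (e.factorial : ℝ) ≠ 0 := by positivity
    have h3 : (e : ℝ) + 1 ≠ 0 := by positivity
    push_cast
    simp only [id, mul_one]
    field_simp
  have h4 := HasDerivAt.fun_sum h
  simpa using h4

lemma ConditionD.isTaylorSystem {L : ℝ} (hL : 0 ≤ L) {f : ℝ → ℝ} {s : ℕ} (hf : ConditionD L f s) :
    IsTaylorSystem L s fun l => iteratedDerivWithin l f (Set.Icc 0 1) := by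
  rcases s with _ | k
  · refine ⟨fun l hl => absurd hl (Nat.not_lt_zero l), fun l hl x _ y hy => ?_⟩
    obtain rfl : l = 0 := by omega
    simpa using hf.2 y hy
  obtain ⟨hcd, hac, hbd, hder⟩ := hf
  set F : ℕ → ℝ → ℝ := fun l => iteratedDerivWithin l f (Set.Icc 0 1) with hF
  have hFd : ∀ l < k, ∀ x ∈ Set.Icc (0 : ℝ) 1,
      HasDerivWithinAt (F l) (F (l + 1) x) (Set.Icc 0 1) x := by
    intro l hl x hx
    have h1 := (hcd.differentiableOn_iteratedDerivWithin (m := l) (by exact_mod_cast hl)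
      (uniqueDiffOn_Icc zero_lt_one)) x hx
    have h2 := h1.hasDerivWithinAt
    simpa only [hF, iteratedDerivWithin_succ] using h2
  have key : ∀ j l, l + j = k → ∀ x ∈ Set.Icc (0 : ℝ) 1, ∀ y ∈ Set.Icc (0 : ℝ) 1,
      |F l y - ∑ e ∈ Finset.range (j + 1), F (l + e) x * ((y - x) ^ e / (e.factorial : ℝ))| ≤
        L * |y - x| ^ (j + 1) := by
    intro j
    induction j with
    | zero =>
      intro l hl x hx y hy
      obtain rfl : l = k := by omega
      simpa using abs_sub_le_of_absolutelyContinuous hL hac hder hx hy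
    | succ j ih =>
      intro l hl x hx y hy
      have hsub : Set.uIcc x y ⊆ Set.Icc 0 1 := Set.uIcc_subset_Icc hx hy
      have hD : ∀ z ∈ Set.uIcc x y, HasDerivWithinAt
          (fun z => F l z - ∑ e ∈ Finset.range (j + 1 + 1),
            F (l + e) x * ((z - x) ^ e / (e.factorial : ℝ)))
          (F (l + 1) z - ∑ e ∈ Finset.range (j + 1),
            F (l + (e + 1)) x * ((z - x) ^ e / (e.factorial : ℝ))) (Set.uIcc x y) z :=
        fun z hz => ((hFd l (by omega) z (hsub hz)).mono hsub).sub
          (hasDerivAt_taylorSum (fun e => F (l + e) x) x z (j + 1)).hasDerivWithinAt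
      have hB : ∀ z ∈ Set.uIcc x y, ‖F (l + 1) z - ∑ e ∈ Finset.range (j + 1),
          F (l + (e + 1)) x * ((z - x) ^ e / (e.factorial : ℝ))‖ ≤ L * |y - x| ^ (j + 1) := by
        intro z hz
        have h1 := ih (l + 1) (by omega) x hx z (hsub hz)
        simp only [add_assoc, add_comm 1] at h1
        refine h1.trans ?_
        have h2 : |z - x| ≤ |y - x| := Set.abs_sub_left_of_mem_uIcc hz
        gcongr
      have h3 := (convex_uIcc x y).norm_image_sub_le_of_norm_hasDerivWithin_le hD hB
        Set.left_mem_uIcc Set.right_mem_uIcc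
      have h4 : F l x - ∑ e ∈ Finset.range (j + 1 + 1),
          F (l + e) x * ((x - x) ^ e / (e.factorial : ℝ)) = 0 := by
        rw [Finset.sum_range_succ']
        simp
      rw [h4, sub_zero, Real.norm_eq_abs, Real.norm_eq_abs] at h3
      exact h3.trans_eq (by ring)
  refine ⟨fun l hl x hx => hbd l (by omega) x hx, fun l hl x hx y hy => ?_⟩
  have hlk : l ≤ k := by omega
  have h1 := key (k - l) l (by omega) x hx y hy
  rwa [show k - l + 1 = k + 1 - l by omega] at h1

lemma IsTaylorSystem.mono {M : ℝ} (hM : 0 ≤ M) {s s' : ℕ} {F : ℕ → ℝ → ℝ}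
    (hF : IsTaylorSystem M s F) (hs : s' ≤ s) : IsTaylorSystem (M * (1 + s)) s' F := by
  have hs0 : (0 : ℝ) ≤ s := Nat.cast_nonneg s
  refine ⟨fun l hl x hx => (hF.1 l (by omega) x hx).trans (by nlinarith),
    fun l hl x hx y hy => ?_⟩
  have hd : |y - x| ≤ 1 := abs_le.2 ⟨by linarith [hx.2, hy.1], by linarith [hx.1, hy.2]⟩
  have h1 := hF.2 l (by omega) x hx y hy
  have h2 : s - l = (s' - l) + (s - l - (s' - l)) := by omega
  have hpow : ∀ {e : ℕ}, s' - l ≤ e → |y - x| ^ e ≤ |y - x| ^ (s' - l) := fun he =>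
    pow_le_pow_of_le_one (abs_nonneg _) hd he
  rw [h2, Finset.sum_range_add, ← h2, ← sub_sub] at h1
  have h3 : |∑ e ∈ Finset.range (s - l - (s' - l)), F (l + (s' - l + e)) x *
      ((y - x) ^ (s' - l + e) / ((s' - l + e).factorial : ℝ))| ≤
      ∑ e ∈ Finset.range (s - l - (s' - l)), M * |y - x| ^ (s' - l) := by
    refine (Finset.abs_sum_le_sum_abs _ _).trans (Finset.sum_le_sum fun e he => ?_)
    have he' := Finset.mem_range.1 he
    rw [abs_mul, abs_div, abs_pow, Nat.abs_cast]
    refine mul_le_mul (hF.1 _ (by omega) x hx) ?_ (by positivity) hM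
    refine (div_le_self (by positivity) ?_).trans (hpow (by omega))
    exact_mod_cast Nat.factorial_pos _
  rw [Finset.sum_const, Finset.card_range, nsmul_eq_mul] at h3
  have h4 : ((s - l - (s' - l) : ℕ) : ℝ) ≤ s := by exact_mod_cast (by omega)
  have h5 : ((s - l - (s' - l) : ℕ) : ℝ) * (M * |y - x| ^ (s' - l)) ≤
      s * (M * |y - x| ^ (s' - l)) := by gcongr
  have h6 : M * |y - x| ^ (s - l) ≤ M * |y - x| ^ (s' - l) :=
    mul_le_mul_of_nonneg_left (hpow (by omega)) hM
  rw [abs_le] at h1 h3 ⊢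
  constructor <;> nlinarith

/-- Taylor's formula at `x`, after subtracting the Taylor polynomial at `p` from `F 0`. -/
lemma IsTaylorSystem.abs_sub_sub_le {M : ℝ} {s : ℕ} {F : ℕ → ℝ → ℝ} (hF : IsTaylorSystem M s F)
    (p : ℝ) {x y : ℝ} (hx : x ∈ Set.Icc (0 : ℝ) 1) (hy : y ∈ Set.Icc (0 : ℝ) 1) :
    |F 0 y - ∑ d ∈ Finset.range s, F d p * ((y - p) ^ d / (d.factorial : ℝ)) -
      ∑ l ∈ Finset.range s, (F l x - ∑ e ∈ Finset.range (s - l),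
        F (l + e) p * ((x - p) ^ e / (e.factorial : ℝ))) * ((y - x) ^ l / (l.factorial : ℝ))| ≤
      M * |y - x| ^ s := by
  have h1 := hF.2 0 (Or.inl rfl) x hx y hy
  simp only [zero_add, tsub_zero] at h1
  have h2 : ∑ d ∈ Finset.range s, F d p * ((y - p) ^ d / (d.factorial : ℝ)) =
      ∑ l ∈ Finset.range s, (∑ e ∈ Finset.range (s - l),
        F (l + e) p * ((x - p) ^ e / (e.factorial : ℝ))) * ((y - x) ^ l / (l.factorial : ℝ)) := by
    simp only [Finset.sum_mul]
    rw [← Finset.sum_range_diag_flip s fun l e =>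
      F (l + e) p * ((x - p) ^ e / (e.factorial : ℝ)) * ((y - x) ^ l / (l.factorial : ℝ))]
    refine Finset.sum_congr rfl fun d _ => ?_
    have h3 : y - p = (y - x) + (x - p) := by ring
    rw [h3, add_pow, Finset.sum_div, Finset.mul_sum]
    refine Finset.sum_congr rfl fun l hl => ?_
    have hld : l ≤ d := by have := Finset.mem_range.1 hl; omega
    rw [Nat.add_sub_of_le hld, Nat.cast_choose ℝ hld]
    have h4 : (d.factorial : ℝ) ≠ 0 := by positivity
    field_simp
  rw [h2, sub_sub, ← Finset.sum_add_distrib]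
  refine le_of_eq_of_le (congrArg abs (congrArg (F 0 y - ·) ?_)) h1
  exact Finset.sum_congr rfl fun l _ => by ring

/-! ### The bias as a jackknife combination of binomial expectations -/

instance (n : ℕ) (p : unitInterval) : IsProbabilityMeasure (sampleLaw n p) := by
  unfold sampleLaw
  infer_instance

lemma integral_sampleLaw_comp_embedding {n q : ℕ} (e : Fin q → Fin n) (he : Function.Injective e)
    (p : unitInterval) (g : (Fin q → Bool) → ℝ) :
    ∫ X, g (fun k => X (e k)) ∂(sampleLaw n p) = ∫ x, g x ∂(sampleLaw q p) := by
  have h1 : iIndepFun (fun (j : Fin n) (X : Fin n → Bool) => X j) (sampleLaw n p) :=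
    iIndepFun_pi (X := fun _ b => b) fun _ => aemeasurable_id
  have h2 := (h1.precomp he).map_fun_eq_pi_map fun k => (measurable_pi_apply _).aemeasurable
  have h3 : ∀ j, (sampleLaw n p).map (fun X : Fin n → Bool => X j) =
      bernoulliMeasure true false p := fun j => (measurePreserving_eval _ j).map_eq
  simp only [h3] at h2
  rw [sampleLaw, sampleLaw] at *
  rw [← h2, integral_map Measurable.of_discrete.aemeasurable
    Measurable.of_discrete.aestronglyMeasurable]

lemma integral_sampleLaw_sum (p : unitInterval) (q : ℕ) : ∀ ψ : ℝ → ℝ,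
    ∫ x, ψ (∑ k, if x k then (1 : ℝ) else 0) ∂(sampleLaw q p) =
      binomMean p q fun k => ψ k := by
  induction q with
  | zero =>
    intro ψ
    simp [binomMean]
  | succ q ih =>
    intro ψ
    have h := (measurePreserving_piFinSuccAbove
      (fun _ : Fin (q + 1) => bernoulliMeasure true false p) 0).symm
    rw [sampleLaw, ← h.integral_comp']
    rw [integral_prod _ (Integrable.of_finite), integral_bernoulliMeasure]
    have h2 : ∀ b : Bool, ∫ x : Fin q → Bool, ψ (∑ k : Fin (q + 1),
        if (MeasurableEquiv.piFinSuccAbove (fun _ => Bool) 0).symm (b, x) k then (1 : ℝ) else 0)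
          ∂(Measure.pi fun _ => bernoulliMeasure true false p) =
        binomMean p q fun k => ψ ((if b then 1 else 0) + k) := by
      intro b
      rw [← ih fun t => ψ ((if b then 1 else 0) + t)]
      simp only [Fin.sum_univ_succ, MeasurableEquiv.piFinSuccAbove, sampleLaw]
      rfl
    simp only [h2]
    simp only [binomMean, smul_eq_mul, if_true, Bool.false_eq_true, if_false, zero_add,
      Nat.cast_add, Nat.cast_one, add_comm (1 : ℝ)]
    exact add_comm _ _

lemma integral_uStatistic {n q : ℕ} (hq : q ≤ n) (p : unitInterval) (f : ℝ → ℝ) :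
    ∫ X, uStatistic (n := n) (fun x : Fin q → Bool => f (empiricalFreq x)) X ∂(sampleLaw n p) =
      binomMean p q fun k => f ((k : ℝ) / q) := by
  have h0 : (n.choose q : ℝ) ≠ 0 := by exact_mod_cast (Nat.choose_pos hq).ne'
  simp only [uStatistic]
  rw [integral_div, integral_finsetSum _ fun β _ => Integrable.of_finite]
  have h1 : ∀ β : {β : Finset (Fin n) // β.card = q},
      ∫ X : Fin n → Bool, f (empiricalFreq fun k => X (β.1.orderEmbOfFin β.2 k)) ∂(sampleLaw n p) =
        binomMean p q fun k => f ((k : ℝ) / q) := by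
    intro β
    rw [integral_sampleLaw_comp_embedding (β.1.orderEmbOfFin β.2)
      (β.1.orderEmbOfFin β.2).injective p fun x => f (empiricalFreq x)]
    exact integral_sampleLaw_sum p q fun t => f (t / q)
  have h2 : Fintype.card {β : Finset (Fin n) // β.card = q} = n.choose q := by
    simp
  simp only [h1, Finset.sum_const, Finset.card_univ, h2, nsmul_eq_mul]
  field_simp

lemma deleteOneBias_eq {r n : ℕ} (hrn : r ≤ n) (f : ℝ → ℝ) (p : unitInterval) :
    deleteOneBias r n f p = jackSum Finset.univ (fun i : Fin r => ((n + 1 - r + i : ℕ) : ℝ))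
      (fun i => binomMean p (n + 1 - r + i) fun k => f ((k : ℝ) / (n + 1 - r + i : ℕ))) - f p := by
  have h : deleteOneSizes r n = fun i : Fin r => n + 1 - r + i := by
    funext i
    simp only [deleteOneSizes]
    omega
  unfold deleteOneBias deleteOne estimator
  rw [integral_finsetSum _ fun i _ => Integrable.of_finite, h, jackSum]
  congr 1
  refine Finset.sum_congr rfl fun i _ => ?_
  rw [integral_const_mul, integral_uStatistic (by dsimp only; omega)]
  rfl

/-! ### The three contributions to the bias -/

lemma jackSum_binomMean {ι : Type*} [DecidableEq ι] (S : Finset ι) (N : ι → ℝ) (p : ℝ) (q : ℕ)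
    (φ : ι → ℕ → ℝ) : jackSum S N (fun i => binomMean p q (φ i)) =
      binomMean p q fun k => jackSum S N fun i => φ i k := by
  simp only [jackSum]
  rw [binomMean_sum]
  exact Finset.sum_congr rfl fun i _ => (binomMean_const_mul _ _ _).symm

lemma abs_jackSum_le {r m : ℕ} {φ : Fin r → ℝ} {B : ℝ} (hφ : ∀ i, |φ i| ≤ B) :
    |jackSum Finset.univ (fun i : Fin r => ((m + i : ℕ) : ℝ)) φ| ≤
      r * ((m + r : ℝ) ^ (r - 1) * B) := by
  rw [jackSum]
  have h : ∀ i : Fin r, |(∏ j ∈ Finset.univ.erase i,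
      ((m + i : ℕ) : ℝ) / (((m + i : ℕ) : ℝ) - ((m + j : ℕ) : ℝ))) * φ i| ≤
      (m + r : ℝ) ^ (r - 1) * B := by
    intro i
    rw [abs_mul, Finset.abs_prod]
    refine mul_le_mul ?_ (hφ i) (abs_nonneg _) (by positivity)
    have hc : (Finset.univ.erase i).card = r - 1 := by simp
    rw [← hc, ← Finset.prod_const]
    refine Finset.prod_le_prod (fun j _ => abs_nonneg _) fun j hj => ?_
    have hji : (j : ℕ) ≠ i := fun h => (Finset.mem_erase.1 hj).1 (Fin.ext h)
    have h1 : (1 : ℝ) ≤ |((m + i : ℕ) : ℝ) - ((m + j : ℕ) : ℝ)| := by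
      have : (1 : ℤ) ≤ |((m + i : ℕ) : ℤ) - ((m + j : ℕ) : ℤ)| :=
        Int.one_le_abs (by push_cast; omega)
      exact_mod_cast this
    have h2 : ((m + i : ℕ) : ℝ) ≤ m + r := by exact_mod_cast (by omega : m + i ≤ m + r)
    rw [abs_div, Nat.abs_cast]
    exact (div_le_self (Nat.cast_nonneg _) h1).trans h2
  calc _ ≤ ∑ i : Fin r, (m + r : ℝ) ^ (r - 1) * B :=
        (Finset.abs_sum_le_sum_abs _ _).trans (Finset.sum_le_sum fun i _ => h i)
    _ = _ := by simp

/-- The Taylor polynomial at `p` contributes `O(m^{-r})`. -/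
lemma exists_abs_jackSum_taylorPoly_sub_le (r s : ℕ) (hr : 1 ≤ r) {M : ℝ} (hM : 0 ≤ M) : ∃ K : ℝ,
    0 ≤ K ∧ ∀ p ∈ Set.Icc (0 : ℝ) 1, ∀ (m : ℕ) (c : ℕ → ℝ), 0 < m → (∀ d, |c d| ≤ M) →
      |jackSum Finset.univ (fun i : Fin r => ((m + i : ℕ) : ℝ)) (fun i => binomMean p (m + i)
        fun k => ∑ d ∈ Finset.range (s + 1),
          c d * (((k : ℝ) / (m + i : ℕ) - p) ^ d / (d.factorial : ℝ))) - c 0| ≤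
        K * (m : ℝ)⁻¹ ^ r := by
  choose K hK0 hK using fun d : ℕ =>
    exists_abs_jackSum_centralMoment_freq_le (ι := Fin r) (Nat.succ_pos d) r
  refine ⟨∑ d ∈ Finset.range s, M * K d, Finset.sum_nonneg fun d _ => mul_nonneg hM (hK0 d),
    fun p hp m c hm hc => ?_⟩
  have hpos : ∀ i : Fin r, (0 : ℝ) < ((m + i : ℕ) : ℝ) := fun i => by
    exact_mod_cast (by omega : 0 < m + i)
  have hinj : Set.InjOn (fun i : Fin r => (i : ℕ)) (Finset.univ : Finset (Fin r)) :=
    fun i _ j _ h => Fin.ext h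
  have hmom : ∀ (d : ℕ) (i : Fin r), binomMean p (m + i) (fun k =>
      c d * (((k : ℝ) / (m + i : ℕ) - p) ^ d / (d.factorial : ℝ))) =
      c d / (d.factorial : ℝ) * (centralMoment p d (m + i) * ((m + i : ℕ) : ℝ)⁻¹ ^ d) := by
    intro d i
    rw [centralMoment, mul_comm (binomMean _ _ _), ← mul_assoc, ← binomMean_const_mul]
    refine binomMean_congr fun k _ => ?_
    have h1 := (hpos i).ne'
    have h2 : (k : ℝ) / (m + i : ℕ) - p = ((m + i : ℕ) : ℝ)⁻¹ * (k - (m + i : ℕ) * p) := by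
      field_simp
    rw [h2, mul_pow]
    ring
  simp only [binomMean_sum, hmom]
  rw [jackSum_sum, Finset.sum_range_succ']
  simp only [jackSum_const_mul]
  have h0 : jackSum Finset.univ (fun i : Fin r => ((m + i : ℕ) : ℝ))
      (fun i => centralMoment p 0 (m + i) * ((m + i : ℕ) : ℝ)⁻¹ ^ 0) = 1 := by
    simp only [centralMoment, pow_zero, binomMean_const, mul_one]
    exact jackSum_one (fun i hi j hj h => hinj hi hj (by simpa using h)) (fun i _ => hpos i)
      ⟨⟨0, hr⟩, Finset.mem_univ _⟩
  rw [h0, Nat.factorial_zero, Nat.cast_one, div_one, mul_one, add_sub_cancel_right, Finset.sum_mul]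
  refine (Finset.abs_sum_le_sum_abs _ _).trans (Finset.sum_le_sum fun d _ => ?_)
  have h1 := hK d p hp Finset.univ m (fun i => (i : ℕ)) (by simp) hm hinj
  have h2 : |c (d + 1) / ((d + 1).factorial : ℝ)| ≤ M := by
    rw [abs_div, Nat.abs_cast]
    exact (div_le_self (abs_nonneg _) (by exact_mod_cast Nat.factorial_pos _)).trans (hc _)
  rw [abs_mul, mul_assoc]
  exact mul_le_mul h2 h1 (abs_nonneg _) hM

/-- Moments of the increment `(k + Y_i) / (m + i) - k / m` of the empirical frequency. -/
lemma binomMean_increment_pow (p : ℝ) {m : ℕ} (hm : 0 < m) (i k l : ℕ) :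
    binomMean p i (fun h => (((k + h : ℕ) : ℝ) / (m + i : ℕ) - (k : ℝ) / m) ^ l) =
      ∑ a ∈ Finset.range (l + 1), ((l.choose a : ℝ) * (p - k / m) ^ (l - a)) *
        (centralMoment p a i * (i : ℝ) ^ (l - a) * ((m + i : ℕ) : ℝ)⁻¹ ^ l) := by
  have hm' : (m : ℝ) ≠ 0 := by exact_mod_cast hm.ne'
  have hmi : (m : ℝ) + i ≠ 0 := by positivity
  have h1 : ∀ a, ((l.choose a : ℝ) * (p - k / m) ^ (l - a)) *
      (centralMoment p a i * (i : ℝ) ^ (l - a) * ((m + i : ℕ) : ℝ)⁻¹ ^ l) =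
      binomMean p i fun h => (((l.choose a : ℝ) * (p - k / m) ^ (l - a)) *
        ((i : ℝ) ^ (l - a) * ((m + i : ℕ) : ℝ)⁻¹ ^ l)) * ((h : ℝ) - i * p) ^ a := by
    intro a
    rw [binomMean_const_mul, centralMoment]
    ring
  simp only [h1]
  rw [← binomMean_sum]
  refine binomMean_congr fun h _ => ?_
  have h2 : ((k + h : ℕ) : ℝ) / (m + i : ℕ) - (k : ℝ) / m =
      ((h - i * p) + i * (p - k / m)) * ((m + i : ℕ) : ℝ)⁻¹ := by
    push_cast
    field_simp
    ring
  rw [h2, mul_pow, add_pow, Finset.sum_mul]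
  refine Finset.sum_congr rfl fun a _ => ?_
  rw [mul_pow]
  ring

/-- The Taylor polynomial at the random point `S_m / m` contributes `O(m^{-s/2})`, as soon as its
`l`-th coefficient is `O(|S_m / m - p|^{s-l})`. -/
lemma exists_abs_jackSum_increment_le (r s : ℕ) {M : ℝ} (hM : 0 ≤ M) : ∃ K : ℝ, 0 ≤ K ∧
    ∀ p ∈ Set.Icc (0 : ℝ) 1, ∀ (m : ℕ) (A : ℕ → ℕ → ℝ), 0 < m →
      (∀ l < s, ∀ k ≤ m, |A l k| ≤ M * |(k : ℝ) / m - p| ^ (s - l)) →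
      |jackSum Finset.univ (fun i : Fin r => ((m + i : ℕ) : ℝ)) (fun i => binomMean p m
        fun k => binomMean p i fun h => ∑ l ∈ Finset.range s,
          A l k * ((((k + h : ℕ) : ℝ) / (m + i : ℕ) - (k : ℝ) / m) ^ l / (l.factorial : ℝ)))| ≤
        K * (√m)⁻¹ ^ s := by
  choose K hK0 hK using fun a b => exists_abs_jackSum_centralMoment_le (ι := Fin r) a b
  choose K' hK0' hK' using exists_binomMean_abs_pow_le
  refine ⟨∑ l ∈ Finset.range s, ∑ a ∈ Finset.range (l + 1),
    M * (l.choose a : ℝ) * K a (l - a) * K' (s - a), ?_, fun p hp m A hm hA => ?_⟩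
  · exact Finset.sum_nonneg fun l _ => Finset.sum_nonneg fun a _ => mul_nonneg (mul_nonneg
      (mul_nonneg hM (Nat.cast_nonneg _)) (hK0 _ _)) (hK0' _)
  have hinj : Set.InjOn (fun i : Fin r => (i : ℕ)) (Finset.univ : Finset (Fin r)) :=
    fun i _ j _ h => Fin.ext h
  have hmean : ∀ (i : Fin r) (k : ℕ), binomMean p i (fun h => ∑ l ∈ Finset.range s,
      A l k * ((((k + h : ℕ) : ℝ) / (m + i : ℕ) - (k : ℝ) / m) ^ l / (l.factorial : ℝ))) =
      ∑ l ∈ Finset.range s, ∑ a ∈ Finset.range (l + 1),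
        (A l k / (l.factorial : ℝ) * ((l.choose a : ℝ) * (p - k / m) ^ (l - a))) *
        (centralMoment p a i * (i : ℝ) ^ (l - a) * ((m + i : ℕ) : ℝ)⁻¹ ^ l) := by
    intro i k
    rw [binomMean_sum]
    refine Finset.sum_congr rfl fun l _ => ?_
    simp only [mul_assoc (A l k / (l.factorial : ℝ))]
    rw [← Finset.mul_sum, ← binomMean_increment_pow p hm, ← binomMean_const_mul]
    exact binomMean_congr fun h _ => by ring
  simp only [hmean]
  rw [jackSum_binomMean]
  simp only [jackSum_sum, jackSum_const_mul]
  have hpt : ∀ k ≤ m, |∑ l ∈ Finset.range s, ∑ a ∈ Finset.range (l + 1),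
      (A l k / (l.factorial : ℝ) * ((l.choose a : ℝ) * (p - k / m) ^ (l - a))) *
      jackSum Finset.univ (fun i : Fin r => ((m + i : ℕ) : ℝ))
        (fun i => centralMoment p a i * (i : ℝ) ^ (l - a) * ((m + i : ℕ) : ℝ)⁻¹ ^ l)| ≤
      ∑ l ∈ Finset.range s, ∑ a ∈ Finset.range (l + 1),
        (M * (l.choose a : ℝ) * K a (l - a) * (√m)⁻¹ ^ a) * |(k : ℝ) / m - p| ^ (s - a) := by
    intro k hk
    refine (Finset.abs_sum_le_sum_abs _ _).trans (Finset.sum_le_sum fun l hl => ?_)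
    refine (Finset.abs_sum_le_sum_abs _ _).trans (Finset.sum_le_sum fun a ha => ?_)
    have hls := Finset.mem_range.1 hl
    have hal : a ≤ l := by have := Finset.mem_range.1 ha; omega
    have h1 := hK a (l - a) p hp Finset.univ m (fun i => (i : ℕ)) hm hinj
    rw [Nat.add_sub_of_le hal] at h1
    have h2 : |A l k / (l.factorial : ℝ)| ≤ M * |(k : ℝ) / m - p| ^ (s - l) := by
      rw [abs_div, Nat.abs_cast]
      exact (div_le_self (abs_nonneg _) (by exact_mod_cast Nat.factorial_pos _)).trans
        (hA l hls k hk)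
    rw [abs_mul, abs_mul, abs_mul, abs_pow, Nat.abs_cast, abs_sub_comm p]
    have h3 : s - a = (s - l) + (l - a) := by omega
    calc _ ≤ (M * |(k : ℝ) / m - p| ^ (s - l) * ((l.choose a : ℝ) *
            |(k : ℝ) / m - p| ^ (l - a))) * (K a (l - a) * (√m)⁻¹ ^ a) := by gcongr
      _ = _ := by rw [h3, pow_add]; ring
  refine (abs_binomMean_le hp hpt).trans ?_
  simp only [binomMean_sum, binomMean_const_mul, Finset.sum_mul]
  refine Finset.sum_le_sum fun l hl => Finset.sum_le_sum fun a ha => ?_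
  have has : a ≤ s := by
    have := Finset.mem_range.1 hl
    have := Finset.mem_range.1 ha
    omega
  have hc : 0 ≤ M * (l.choose a : ℝ) * K a (l - a) * (√m)⁻¹ ^ a :=
    mul_nonneg (mul_nonneg (mul_nonneg hM (Nat.cast_nonneg _)) (hK0 _ _)) (by positivity)
  refine (mul_le_mul_of_nonneg_left (hK' (s - a) p hp m hm) hc).trans_eq ?_
  have h4 : (√(m : ℝ))⁻¹ ^ s = (√m)⁻¹ ^ a * (√m)⁻¹ ^ (s - a) := by
    rw [← pow_add, Nat.add_sub_of_le has]
  rw [h4]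
  ring

lemma abs_increment_le {m i k h : ℕ} (hm : 0 < m) (hk : k ≤ m) (hh : h ≤ i) :
    |((k + h : ℕ) : ℝ) / (m + i : ℕ) - (k : ℝ) / m| ≤ i * (m : ℝ)⁻¹ := by
  have hm' : (0 : ℝ) < m := by exact_mod_cast hm
  have hk' : (k : ℝ) ≤ m := by exact_mod_cast hk
  have hh' : (h : ℝ) ≤ i := by exact_mod_cast hh
  have hk0 : (0 : ℝ) ≤ k := Nat.cast_nonneg k
  have hh0 : (0 : ℝ) ≤ h := Nat.cast_nonneg h
  have hi0 : (0 : ℝ) ≤ i := Nat.cast_nonneg i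
  have h1 : ((k + h : ℕ) : ℝ) / (m + i : ℕ) - (k : ℝ) / m = (h - i * (k / m)) / (m + i) := by
    push_cast
    field_simp
    ring
  have h2 : (k : ℝ) / m ≤ 1 := (div_le_one hm').2 hk'
  have h3 : (0 : ℝ) ≤ k / m := by positivity
  rw [h1, abs_div, abs_of_pos (by positivity : (0 : ℝ) < m + i), div_eq_mul_inv]
  refine mul_le_mul (abs_le.2 ⟨by nlinarith, by nlinarith⟩) ?_ (by positivity) hi0
  exact inv_anti₀ hm' (by linarith)

/-- The bias bound in terms of the smallest sample size `m`. -/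
lemma exists_abs_bias_le (r s : ℕ) (hr : 1 ≤ r) {M : ℝ} (hM : 0 ≤ M) : ∃ K : ℝ, 0 ≤ K ∧
    ∀ F, IsTaylorSystem M s F → ∀ p ∈ Set.Icc (0 : ℝ) 1, ∀ m : ℕ, 0 < m →
      |jackSum Finset.univ (fun i : Fin r => ((m + i : ℕ) : ℝ)) (fun i => binomMean p (m + i)
        fun k => F 0 ((k : ℝ) / (m + i : ℕ))) - F 0 p| ≤
        K * ((√m)⁻¹ ^ s + (m + r) ^ (r - 1) * (m : ℝ)⁻¹ ^ s + (m : ℝ)⁻¹ ^ r) := by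
  obtain ⟨K₂, hK₂0, hK₂⟩ := exists_abs_jackSum_increment_le r s hM
  have hpoly : ∃ K : ℝ, 0 ≤ K ∧ ∀ F, IsTaylorSystem M s F → ∀ p ∈ Set.Icc (0 : ℝ) 1, ∀ m : ℕ,
      0 < m → |jackSum Finset.univ (fun i : Fin r => ((m + i : ℕ) : ℝ)) (fun i =>
        binomMean p (m + i) fun k => ∑ d ∈ Finset.range s,
          F d p * (((k : ℝ) / (m + i : ℕ) - p) ^ d / (d.factorial : ℝ))) - F 0 p| ≤
        K * ((√m)⁻¹ ^ s + (m : ℝ)⁻¹ ^ r) := by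
    rcases s with _ | s
    · refine ⟨M, hM, fun F hF p hp m hm => ?_⟩
      have h1 : |F 0 p| ≤ M := by simpa using hF.2 0 (Or.inl rfl) p hp p hp
      have h2 : (0 : ℝ) ≤ (m : ℝ)⁻¹ ^ r := by positivity
      simp only [Finset.range_zero, Finset.sum_empty, binomMean_const, jackSum, mul_zero,
        Finset.sum_const_zero, zero_sub, abs_neg, pow_zero]
      nlinarith
    · obtain ⟨K, hK0, hK⟩ := exists_abs_jackSum_taylorPoly_sub_le r s hr hM
      refine ⟨K, hK0, fun F hF p hp m hm => ?_⟩
      have h1 := hK p hp m (fun d => if d < s + 1 then F d p else 0) hm fun d => by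
        split_ifs with hd
        · exact hF.1 d hd p hp
        · simpa using hM
      have h2 : ∀ x : ℝ, ∑ d ∈ Finset.range (s + 1), (if d < s + 1 then F d p else 0) *
          (x ^ d / (d.factorial : ℝ)) =
          ∑ d ∈ Finset.range (s + 1), F d p * (x ^ d / (d.factorial : ℝ)) := fun x =>
        Finset.sum_congr rfl fun d hd => by rw [if_pos (Finset.mem_range.1 hd)]
      simp only [h2, Nat.succ_pos, if_true] at h1
      refine h1.trans (mul_le_mul_of_nonneg_left ?_ hK0)
      have : (0 : ℝ) ≤ (√m)⁻¹ ^ (s + 1) := by positivity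
      linarith
  obtain ⟨K₁, hK₁0, hK₁⟩ := hpoly
  refine ⟨K₁ + K₂ + r * (M * r ^ s), by positivity, fun F hF p hp m hm => ?_⟩
  have hm' : (0 : ℝ) < m := by exact_mod_cast hm
  set N : Fin r → ℝ := fun i => ((m + i : ℕ) : ℝ) with hN
  set P : ℝ → ℝ := fun y => ∑ d ∈ Finset.range s, F d p * ((y - p) ^ d / (d.factorial : ℝ)) with hP
  set A : ℕ → ℕ → ℝ := fun l k => F l ((k : ℝ) / m) - ∑ e ∈ Finset.range (s - l),
    F (l + e) p * (((k : ℝ) / m - p) ^ e / (e.factorial : ℝ)) with hA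
  set Q : Fin r → ℕ → ℕ → ℝ := fun i k h => ∑ l ∈ Finset.range s,
    A l k * ((((k + h : ℕ) : ℝ) / (m + i : ℕ) - (k : ℝ) / m) ^ l / (l.factorial : ℝ)) with hQ
  have hmem : ∀ {k q : ℕ}, 0 < q → k ≤ q → (k : ℝ) / q ∈ Set.Icc (0 : ℝ) 1 := fun hq hk =>
    ⟨by positivity, (div_le_one (by exact_mod_cast hq)).2 (by exact_mod_cast hk)⟩
  have hsplit : ∀ i : Fin r, binomMean p (m + i) (fun k => F 0 ((k : ℝ) / (m + i : ℕ))) =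
      (binomMean p (m + i) (fun k => P ((k : ℝ) / (m + i : ℕ))) +
        binomMean p m fun k => binomMean p i fun h => Q i k h) +
      binomMean p m fun k => binomMean p i fun h => F 0 (((k + h : ℕ) : ℝ) / (m + i : ℕ)) -
        P (((k + h : ℕ) : ℝ) / (m + i : ℕ)) - Q i k h := by
    intro i
    rw [binomMean_add_trials, binomMean_add_trials, ← binomMean_add, ← binomMean_add]
    refine binomMean_congr fun k _ => ?_
    rw [← binomMean_add, ← binomMean_add]
    exact binomMean_congr fun h _ => by ring
  have hrem : ∀ i : Fin r, |binomMean p m fun k => binomMean p i fun h =>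
      F 0 (((k + h : ℕ) : ℝ) / (m + i : ℕ)) - P (((k + h : ℕ) : ℝ) / (m + i : ℕ)) - Q i k h| ≤
      M * (r * (m : ℝ)⁻¹) ^ s := by
    intro i
    rw [← binomMean_const (p := p) (M * (r * (m : ℝ)⁻¹) ^ s) m]
    refine abs_binomMean_le hp fun k hk => ?_
    rw [← binomMean_const (p := p) (M * (r * (m : ℝ)⁻¹) ^ s) i]
    refine abs_binomMean_le hp fun h hh => ?_
    have h1 := hF.abs_sub_sub_le p (hmem hm hk)
      (hmem (by omega : 0 < m + (i : ℕ)) (by omega : k + h ≤ m + i))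
    refine h1.trans (mul_le_mul_of_nonneg_left (pow_le_pow_left₀ (abs_nonneg _)
      ((abs_increment_le hm hk hh).trans ?_) s) hM)
    have : ((i : ℕ) : ℝ) ≤ r := by exact_mod_cast i.2.le
    gcongr
  have hcoef : ∀ l < s, ∀ k ≤ m, |A l k| ≤ M * |(k : ℝ) / m - p| ^ (s - l) :=
    fun l hl k hk => hF.2 l (Or.inr hl) p hp _ (hmem hm hk)
  have b1 := hK₁ F hF p hp m hm
  have b2 := hK₂ p hp m A hm hcoef
  have b3 := abs_jackSum_le (m := m) hrem
  simp only [hsplit]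
  rw [jackSum_add, jackSum_add]
  have e3 : r * ((m + r : ℝ) ^ (r - 1) * (M * (r * (m : ℝ)⁻¹) ^ s)) =
      r * (M * r ^ s) * ((m + r : ℝ) ^ (r - 1) * (m : ℝ)⁻¹ ^ s) := by
    rw [mul_pow]; ring
  rw [e3] at b3
  have n1 : (0 : ℝ) ≤ (√m)⁻¹ ^ s := by positivity
  have n2 : (0 : ℝ) ≤ (m + r : ℝ) ^ (r - 1) * (m : ℝ)⁻¹ ^ s := by positivity
  have n3 : (0 : ℝ) ≤ (m : ℝ)⁻¹ ^ r := by positivity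
  have n4 : 0 ≤ r * (M * (r : ℝ) ^ s) := by positivity
  have tri : ∀ a b c d : ℝ, |a + b + c - d| ≤ |a - d| + |b| + |c| := fun a b c d => by
    have : a + b + c - d = (a - d) + b + c := by ring
    rw [this]
    exact abs_add_three _ _ _
  refine (tri _ _ _ _).trans ((add_le_add (add_le_add b1 b2) b3).trans ?_)
  have := mul_nonneg hK₁0 n2
  have := mul_nonneg hK₂0 n2
  have := mul_nonneg hK₂0 n3
  have := mul_nonneg n4 n1
  have := mul_nonneg n4 n3
  linarith

/-! ### The rates -/

/-- The bias bound in terms of the number of samples, as a sum of powers. -/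
lemma exists_abs_deleteOneBias_le (r s : ℕ) (hr : 1 ≤ r) {M : ℝ} (hM : 0 ≤ M) : ∃ K : ℝ, 0 ≤ K ∧
    ∀ F, IsTaylorSystem M s F → ∀ n : ℕ, r ≤ n → ∀ p : unitInterval,
      |deleteOneBias r n (F 0) p| ≤ K * ((n : ℝ) ^ (-((s : ℝ) / 2)) +
        (n : ℝ) ^ ((r : ℝ) - (s : ℝ) - 1) + (n : ℝ) ^ (-(r : ℝ))) := by
  obtain ⟨K, hK0, hK⟩ := exists_abs_bias_le r s hr hM
  refine ⟨K * (√r ^ s + 2 ^ (r - 1) * r ^ s + r ^ r), by positivity, fun F hF n hn p => ?_⟩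
  obtain ⟨m, hm⟩ : ∃ m, m = n + 1 - r := ⟨_, rfl⟩
  have hm0 : 0 < m := by omega
  have hmr : (0 : ℝ) < m := by exact_mod_cast hm0
  have hn0 : (0 : ℝ) < n := by exact_mod_cast (by omega : 0 < n)
  have hr1 : (1 : ℝ) ≤ r := by exact_mod_cast hr
  have hnm : (n : ℝ) ≤ r * m := by
    have h1 : n + 1 = m + r := by omega
    have h2 : (n : ℝ) + 1 = m + r := by exact_mod_cast h1
    have h3 : (1 : ℝ) ≤ m := by exact_mod_cast hm0
    nlinarith
  have hmr' : (m : ℝ) + r ≤ 2 * n := by exact_mod_cast (by omega : m + r ≤ 2 * n)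
  have hinv : (m : ℝ)⁻¹ ≤ r * (n : ℝ)⁻¹ := by
    rw [← div_eq_mul_inv, inv_le_comm₀ hmr (by positivity), inv_div]
    exact (div_le_iff₀' (by linarith)).2 hnm
  have hsqrt : (√(m : ℝ))⁻¹ ≤ √r * (√n)⁻¹ := by
    rw [← Real.sqrt_inv, ← Real.sqrt_inv, ← Real.sqrt_mul (by linarith)]
    exact Real.sqrt_le_sqrt hinv
  have e1 : (n : ℝ) ^ (-((s : ℝ) / 2)) = (√n)⁻¹ ^ s := by
    rw [Real.sqrt_eq_rpow, ← Real.rpow_neg hn0.le, ← Real.rpow_mul_natCast hn0.le]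
    congr 1
    ring
  have e2 : (n : ℝ) ^ ((r : ℝ) - (s : ℝ) - 1) = (n : ℝ) ^ (r - 1) * (n : ℝ)⁻¹ ^ s := by
    have : (r : ℝ) - s - 1 = ((r - 1 : ℕ) : ℝ) - s := by
      rw [Nat.cast_sub hr]; push_cast; ring
    rw [this, Real.rpow_sub hn0, Real.rpow_natCast, Real.rpow_natCast, inv_pow, div_eq_mul_inv]
  have e3 : (n : ℝ) ^ (-(r : ℝ)) = (n : ℝ)⁻¹ ^ r := by
    rw [Real.rpow_neg hn0.le, Real.rpow_natCast, inv_pow]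
  rw [deleteOneBias_eq hn, ← hm, e1, e2, e3, mul_assoc]
  refine (hK F hF p p.2 m hm0).trans (mul_le_mul_of_nonneg_left ?_ hK0)
  have b1 : (√(m : ℝ))⁻¹ ^ s ≤ √r ^ s * (√n)⁻¹ ^ s := by
    rw [← mul_pow]
    exact pow_le_pow_left₀ (by positivity) hsqrt s
  have b2 : (m + r : ℝ) ^ (r - 1) * (m : ℝ)⁻¹ ^ s ≤
      2 ^ (r - 1) * r ^ s * ((n : ℝ) ^ (r - 1) * (n : ℝ)⁻¹ ^ s) := by
    calc _ ≤ (2 * n : ℝ) ^ (r - 1) * (r * (n : ℝ)⁻¹) ^ s := by gcongr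
      _ = _ := by rw [mul_pow, mul_pow]; ring
  have b3 : (m : ℝ)⁻¹ ^ r ≤ r ^ r * (n : ℝ)⁻¹ ^ r := by
    rw [← mul_pow]
    exact pow_le_pow_left₀ (by positivity) hinv r
  refine (add_le_add (add_le_add b1 b2) b3).trans ?_
  have n1 : (0 : ℝ) ≤ (√n)⁻¹ ^ s := by positivity
  have n2 : (0 : ℝ) ≤ (n : ℝ) ^ (r - 1) * (n : ℝ)⁻¹ ^ s := by positivity
  have n3 : (0 : ℝ) ≤ (n : ℝ)⁻¹ ^ r := by positivity
  have c1 : (0 : ℝ) ≤ √r ^ s := by positivity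
  have c2 : (0 : ℝ) ≤ 2 ^ (r - 1) * (r : ℝ) ^ s := by positivity
  have c3 : (0 : ℝ) ≤ (r : ℝ) ^ r := by positivity
  nlinarith [mul_nonneg c1 n2, mul_nonneg c1 n3, mul_nonneg c2 n1, mul_nonneg c2 n3,
    mul_nonneg c3 n1, mul_nonneg c3 n2]

end Jackknife

theorem mainTheorem4 (r s : ℕ) (hr : 1 ≤ r) (L : ℝ) (hL : 0 < L) :
    ∃ C : ℝ, 0 < C ∧ ∀ f : ℝ → ℝ, Jackknife.ConditionD L f s →
      ∀ n : ℕ, r ≤ n → ∀ p : unitInterval,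
        (s + 2 ≤ 2 * r →
          |Jackknife.deleteOneBias r n f p| ≤ C * (n : ℝ) ^ ((r : ℝ) - (s : ℝ) - 1)) ∧
        (s + 1 = 2 * r →
          |Jackknife.deleteOneBias r n f p| ≤ C * (n : ℝ) ^ (-((r : ℝ) - 1 / 2))) ∧
        (2 * r ≤ s →
          |Jackknife.deleteOneBias r n f p| ≤ C * (n : ℝ) ^ (-(r : ℝ))) := by
  have hM : 0 ≤ L * (1 + s) := by positivity
  -- orders of smoothness above `2 r` give nothing more than `2 r`
  obtain ⟨K, hK0, hK⟩ := Jackknife.exists_abs_deleteOneBias_le r (min s (2 * r)) hr hM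
  refine ⟨K * 3 + 1, by positivity, fun f hf n hn p => ?_⟩
  have hb := hK _ ((Jackknife.ConditionD.isTaylorSystem hL.le hf).mono hL.le
    (min_le_left s (2 * r))) n hn p
  have hf0 : iteratedDerivWithin 0 f (Set.Icc 0 1) = f := iteratedDerivWithin_zero
  rw [hf0] at hb
  have hn1 : (1 : ℝ) ≤ n := by exact_mod_cast hr.trans hn
  have hfin : ∀ E : ℝ, -(((min s (2 * r) : ℕ) : ℝ) / 2) ≤ E →
      (r : ℝ) - ((min s (2 * r) : ℕ) : ℝ) - 1 ≤ E → -(r : ℝ) ≤ E →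
      |Jackknife.deleteOneBias r n f p| ≤ (K * 3 + 1) * (n : ℝ) ^ E := by
    intro E h1 h2 h3
    have g1 := Real.rpow_le_rpow_of_exponent_le hn1 h1
    have g2 := Real.rpow_le_rpow_of_exponent_le hn1 h2
    have g3 := Real.rpow_le_rpow_of_exponent_le hn1 h3
    have g4 : 0 < (n : ℝ) ^ E := Real.rpow_pos_of_pos (by linarith) E
    nlinarith [mul_le_mul_of_nonneg_left (add_le_add (add_le_add g1 g2) g3) hK0]
  refine ⟨fun h => hfin _ ?_ ?_ ?_, fun h => hfin _ ?_ ?_ ?_, fun h => hfin _ ?_ ?_ ?_⟩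
  · have h' : (s : ℝ) + 2 ≤ 2 * r := by exact_mod_cast h
    rw [min_eq_left (by omega)]; linarith
  · rw [min_eq_left (by omega)]
  · have h' : (s : ℝ) + 2 ≤ 2 * r := by exact_mod_cast h
    linarith
  · have h' : (s : ℝ) + 1 = 2 * r := by exact_mod_cast h
    rw [min_eq_left (by omega)]; linarith
  · have h' : (s : ℝ) + 1 = 2 * r := by exact_mod_cast h
    rw [min_eq_left (by omega)]; linarith
  · linarith
  · rw [min_eq_right h]; push_cast; linarith
  · rw [min_eq_right h]; push_cast; linarith
  · exact le_rfl
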